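/- Let $n,k\ge 1$ be integers and let $$\Omega_k=\{(z,w)\in\mathbb{C}\times\mathbb{C}^{n} : |w_j|<|z|^k<1 \text{ for all } j=1,\dots,n\}.$$ Let $L^2_a(\Omega_k)$ be the Bergman space of holomorphic functions on $\Omega_k$ that are square integrable with respect to Lebesgue measure $dV$ on $\mathbb{C}^{1+n}$. The Bergman kernel of $\Omega_k$ is the function $K_{\Omega_k}$ on $\Omega_k\times\Omega_k$ such that $\overline{K_{\Omega_k}(p,\cdot)}\in L^2_a(\Omega_k)$ for every $p\in\Omega_k$ and such that, for every $f\in L^2(\Omega_k)$, the function $$p\mapsto\int_{\Omega_k}K_{\Omega_k}(p,q)f(q)\,dV(q)$$ is the orthogonal projection of $f$ onto $L^2_a(\Omega_k)$. Theorem. The Bergman kernel of $\Omega_k$ exists, is unique, and is given for all $(z,w),(x,y)\in\Omega_k$ by $$K_{\Omega_k}((z,w),(x,y))=\frac{\eta^{nk}}{\pi^{n+1}(1-\eta)^2\prod_{j=1}^{n}(\eta^{k}-\nu_j)^2},\qquad \eta=z\overline{x},\quad \nu_j=w_j\overline{y}_j .$$ -/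

import Mathlib

open MeasureTheory
open scoped ComplexConjugate

/-- The Bergman space `L²_a(U) = L²(U) ∩ 𝒪(U)` of an open set `U`: functions that are holomorphic
on `U` and square integrable on `U` with respect to the volume (Lebesgue) measure.  Only the
values of the functions on `U` matter. -/
def bergmanSpace {E : Type*} [NormedAddCommGroup E] [NormedSpace ℂ E] [MeasureSpace E]
    (U : Set E) : Set (E → ℂ) :=
  {f | DifferentiableOn ℂ f U ∧ MemLp f 2 (volume.restrict U)}

/-- `g` is the Bergman projection of `f` on `U`: it is the orthogonal projection of `f` onto the
Bergman space, i.e. `g ∈ L²_a(U)` and `f - g` is orthogonal in `L²(U)` to all of `L²_a(U)`. -/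
def IsBergmanProjection {E : Type*} [NormedAddCommGroup E] [NormedSpace ℂ E] [MeasureSpace E]
    (U : Set E) (f g : E → ℂ) : Prop :=
  g ∈ bergmanSpace U ∧ ∀ h ∈ bergmanSpace U, ∫ q in U, (f q - g q) * conj (h q) = 0

/-- `K` is the Bergman kernel of the open set `U`: for each `p ∈ U` the function `q ↦ conj (K p q)`
(the Riesz representative of evaluation at `p`) belongs to the Bergman space, and the integral
operator with kernel `K` is the Bergman projection on the whole of `L²(U)`. -/
structure IsBergmanKernel {E : Type*} [NormedAddCommGroup E] [NormedSpace ℂ E] [MeasureSpace E]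
    (U : Set E) (K : E → E → ℂ) : Prop where
  conj_mem : ∀ p ∈ U, (fun q => conj (K p q)) ∈ bergmanSpace U
  projection : ∀ f : E → ℂ, MemLp f 2 (volume.restrict U) →
    IsBergmanProjection U f (fun p => ∫ q in U, K p q * f q)

/-- The generalized Hartogs triangle
`Ω_k = {(z, w) ∈ ℂ × ℂⁿ : |w_j| < |z|^k < 1 for all j}`. -/
def hartogsOmega (n k : ℕ) : Set (ℂ × (Fin n → ℂ)) :=
  {p | (∀ j, ‖p.2 j‖ < ‖p.1‖ ^ k) ∧ ‖p.1‖ ^ k < 1}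

/-!
The map `(z, u) ↦ (z, zᵏ u)` is a biholomorphism from the product of the punctured unit disc and the
unit polydisc onto `Ω_k`, with complex Jacobian `z ^ (n k)`.  By the transformation rule for Bergman
kernels (`IsReproducingKernel.transfer`) it suffices to know the kernel of that product, which is the
product of the kernels of the factors (`IsReproducingKernel.prod`).

The kernel of the unit disc is `1 / (π (1 - z * conj x) ^ 2)`: on the circle of radius `r` it is a
Cauchy kernel, so that integrating `f` against it over the circle gives, up to constants, the
derivative of `ζ * f ζ` at `r² z`, and the integral over `r` is then evaluated by the fundamental
theorem of calculus (`integral_discKernel_mul`).  A square integrable holomorphic function on the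
punctured disc extends to the disc (`exists_differentiableOn_eqOn_of_mem_bergmanSpace`), hence the
punctured disc has the same kernel.

All of this concerns `IsReproducingKernel`, the property of evaluating Bergman functions by
integration.  It implies `IsBergmanKernel` by an orthogonal projection in `L²`
(`IsReproducingKernel.isBergmanKernel`), and a Bergman kernel is determined on `U × U` because the
difference of two candidates is a Bergman function orthogonal to itself
(`IsBergmanKernel.eq_of_mem`).
-/

/-! ### Reproducing kernels -/

/-- `K` reproduces the Bergman space of `U`: each `conj (K p ·)` with `p ∈ U` is a Bergman function,
integration against `K p` evaluates Bergman functions at `p`, and integration against `K` turns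
every square integrable function into a function that is holomorphic on `U`. -/
structure IsReproducingKernel {E : Type*} [NormedAddCommGroup E] [NormedSpace ℂ E] [MeasureSpace E]
    (U : Set E) (K : E → E → ℂ) : Prop where
  conj_mem : ∀ p ∈ U, (fun q => conj (K p q)) ∈ bergmanSpace U
  reproducing : ∀ h ∈ bergmanSpace U, ∀ p ∈ U, ∫ q in U, K p q * h q = h p
  differentiableOn_integral : ∀ f : E → ℂ, MemLp f 2 (volume.restrict U) →
    DifferentiableOn ℂ (fun p => ∫ q in U, K p q * f q) U

section General

variable {E : Type*} [NormedAddCommGroup E] [NormedSpace ℂ E] [MeasureSpace E] {U : Set E}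

theorem bergmanSpace.add {f g : E → ℂ} (hf : f ∈ bergmanSpace U) (hg : g ∈ bergmanSpace U) :
    (fun q => f q + g q) ∈ bergmanSpace U :=
  ⟨hf.1.add hg.1, hf.2.add hg.2⟩

theorem bergmanSpace.sub {f g : E → ℂ} (hf : f ∈ bergmanSpace U) (hg : g ∈ bergmanSpace U) :
    (fun q => f q - g q) ∈ bergmanSpace U :=
  ⟨hf.1.sub hg.1, hf.2.sub hg.2⟩

theorem bergmanSpace.const_mul {f : E → ℂ} (c : ℂ) (hf : f ∈ bergmanSpace U) :
    (fun q => c * f q) ∈ bergmanSpace U :=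
  ⟨hf.1.const_mul c, hf.2.const_mul c⟩

theorem bergmanSpace.congr {f g : E → ℂ} (hU : MeasurableSet U) (hf : f ∈ bergmanSpace U)
    (h : Set.EqOn g f U) : g ∈ bergmanSpace U :=
  ⟨hf.1.congr h, hf.2.ae_eq ((ae_restrict_mem hU).mono fun _ hq => (h hq).symm)⟩

/-- The classes in `L²(U)` of the functions of the Bergman space. -/
def bergmanSubmodule (U : Set E) : Submodule ℂ (Lp ℂ 2 (volume.restrict U)) where
  carrier := {g | ∃ h ∈ bergmanSpace U, g =ᵐ[volume.restrict U] h}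
  add_mem' := by
    rintro a b ⟨h, hh, ha⟩ ⟨h', hh', hb⟩
    exact ⟨_, bergmanSpace.add hh hh', (Lp.coeFn_add a b).trans (ha.add hb)⟩
  zero_mem' := ⟨fun _ => 0, ⟨differentiableOn_const 0, MemLp.zero⟩, Lp.coeFn_zero _ _ _⟩
  smul_mem' := by
    rintro c a ⟨h, hh, ha⟩
    exact ⟨_, bergmanSpace.const_mul c hh, (Lp.coeFn_smul c a).trans (ha.const_smul c)⟩

theorem integrable_mul_of_memLp_two {α : Type*} [MeasurableSpace α] {μ : Measure α} {k f : α → ℂ}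
    (hk : MemLp (fun q => conj (k q)) 2 μ) (hf : MemLp f 2 μ) :
    Integrable (fun q => k q * f q) μ := by
  have h : MemLp k 2 μ := by simpa [Pi.star_def] using hk.star
  exact h.integrable_mul hf

theorem L2.inner_eq_integral {α : Type*} [MeasurableSpace α] {μ : Measure α} {k f : α → ℂ}
    {F G : Lp ℂ 2 μ} (hG : G =ᵐ[μ] fun q => conj (k q)) (hF : F =ᵐ[μ] f) :
    inner ℂ G F = ∫ q, k q * f q ∂μ := by
  rw [L2.inner_def]
  refine integral_congr_ae ?_
  filter_upwards [hG, hF] with q h1 h2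
  simp [h1, h2, RCLike.inner_apply, mul_comm]

/-- A reproducing kernel is the Bergman kernel.  The Bergman space need not be known to be closed
in `L²(U)`: the projection of `f` to its closure is an `L²` limit of Bergman functions, whose values
at `p` converge to `∫ K p q * f q`, so this integral represents the projection. -/
theorem IsReproducingKernel.isBergmanKernel {K : E → E → ℂ} (hU : MeasurableSet U)
    (hK : IsReproducingKernel U K) : IsBergmanKernel U K := by
  refine ⟨hK.conj_mem, fun f hf => ?_⟩
  set μ : Measure E := volume.restrict U with hμ
  let S := (bergmanSubmodule U).topologicalClosure
  have : CompleteSpace S := (Submodule.isClosed_topologicalClosure _).completeSpace_coe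
  let F : Lp ℂ 2 μ := hf.toLp f
  let g : Lp ℂ 2 μ := S.starProjection F
  have hgS : g ∈ S := S.starProjection_apply_mem F
  have hperp : ∀ s ∈ S, inner ℂ s (F - g) = 0 := fun s hs =>
    Submodule.inner_right_of_mem_orthogonal hs (S.sub_starProjection_mem_orthogonal F)
  have hsub : bergmanSubmodule U ≤ S := Submodule.le_topologicalClosure _
  have hkey : ∀ h ∈ bergmanSpace U, ∀ hh : MemLp h 2 μ, hh.toLp h ∈ bergmanSubmodule U :=
    fun h hb hh => ⟨h, hb, hh.coeFn_toLp⟩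
  obtain ⟨s, hs, hlim⟩ : ∃ s : ℕ → Lp ℂ 2 μ, (∀ i, s i ∈ bergmanSubmodule U) ∧
      Filter.Tendsto s Filter.atTop (nhds g) :=
    mem_closure_iff_seq_limit.1 hgS
  choose h hhb hsh using hs
  -- the values of the approximating Bergman functions converge on `U`
  have hpt : ∀ p ∈ U, Filter.Tendsto (fun i => h i p) Filter.atTop
      (nhds (∫ q in U, K p q * f q)) := by
    intro p hp
    have hkp := hK.conj_mem p hp
    let k : Lp ℂ 2 μ := hkp.2.toLp _
    have hkae : k =ᵐ[μ] fun q => conj (K p q) := hkp.2.coeFn_toLp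
    have e1 : ∫ q in U, K p q * f q = inner ℂ k g := by
      have h0 := hperp k (hsub (hkey _ hkp hkp.2))
      rw [inner_sub_right, sub_eq_zero] at h0
      rw [← h0, L2.inner_eq_integral hkae hf.coeFn_toLp]
    have e2 : ∀ i, h i p = inner ℂ k (s i) := fun i => by
      rw [L2.inner_eq_integral hkae (hsh i), ← hK.reproducing _ (hhb i) p hp]
    rw [e1]
    simp only [e2]
    exact (Filter.Tendsto.inner tendsto_const_nhds hlim)
  have hae : g =ᵐ[μ] fun p => ∫ q in U, K p q * f q := by
    obtain ⟨ns, hns, hconv⟩ := (tendstoInMeasure_of_tendsto_Lp hlim).exists_seq_tendsto_ae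
    filter_upwards [hconv, ae_all_iff.2 hsh, ae_restrict_mem hU] with p h1 h2 h3
    refine tendsto_nhds_unique h1 ?_
    simp only [h2]
    exact (hpt p h3).comp hns.tendsto_atTop
  have hmem : MemLp (fun p => ∫ q in U, K p q * f q) 2 μ := (Lp.memLp g).ae_eq hae
  refine ⟨⟨hK.differentiableOn_integral f hf, hmem⟩, fun b hb => ?_⟩
  have h0 := hperp _ (hsub (hkey b hb hb.2))
  rw [L2.inner_def] at h0
  rw [← h0]
  refine integral_congr_ae ?_
  filter_upwards [hb.2.coeFn_toLp, Lp.coeFn_sub F g, hae, hf.coeFn_toLp] with q h1 h2 h3 h4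
  rw [h1, h2, Pi.sub_apply, h3, h4, RCLike.inner_apply]

theorem IsBergmanKernel.congr {K K' : E → E → ℂ} (hU : MeasurableSet U)
    (hK : IsBergmanKernel U K) (h : ∀ p ∈ U, ∀ q ∈ U, K' p q = K p q) : IsBergmanKernel U K' := by
  have e : ∀ f : E → ℂ, ∀ p ∈ U, ∫ q in U, K' p q * f q = ∫ q in U, K p q * f q := fun f p hp =>
    setIntegral_congr_fun hU fun q hq => by simp [h p hp q hq]
  refine ⟨fun p hp => bergmanSpace.congr hU (hK.conj_mem p hp) fun q hq => by simp [h p hp q hq],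
    fun f hf => ⟨bergmanSpace.congr hU (hK.projection f hf).1 fun p hp => e f p hp, fun b hb => ?_⟩⟩
  rw [← (hK.projection f hf).2 b hb]
  exact setIntegral_congr_fun hU fun q hq => by simp only [e f q hq]

variable [(volume : Measure E).IsOpenPosMeasure]

/-- A Bergman function of norm zero vanishes identically. -/
theorem eqOn_zero_of_integral_mul_conj_eq_zero {h : E → ℂ} (hU : IsOpen U)
    (hh : h ∈ bergmanSpace U) (h0 : ∫ q in U, h q * conj (h q) = 0) : ∀ p ∈ U, h p = 0 := by
  have hi : Integrable (fun q => ‖h q‖ ^ 2) (volume.restrict U) :=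
    (memLp_two_iff_integrable_sq_norm hh.2.1).1 hh.2
  have h1 : ∫ q in U, ‖h q‖ ^ 2 = 0 := by
    have : (fun q => h q * conj (h q)) = fun q => ((‖h q‖ ^ 2 : ℝ) : ℂ) := by
      ext q; simp [Complex.mul_conj, Complex.normSq_eq_norm_sq]
    rw [this, integral_complex_ofReal] at h0
    exact_mod_cast h0
  rw [integral_eq_zero_iff_of_nonneg (fun q => by positivity) hi] at h1
  have h2 : h =ᵐ[volume.restrict U] fun _ => 0 := h1.mono fun q hq => by simpa using hq
  exact Measure.eqOn_open_of_ae_eq h2 hU hh.1.continuousOn continuousOn_const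

/-- The Bergman kernel reproduces Bergman functions, since the error `h - P h` is a Bergman function
orthogonal to itself. -/
theorem IsBergmanKernel.reproducing {K : E → E → ℂ} (hU : IsOpen U) (hK : IsBergmanKernel U K)
    {h : E → ℂ} (hh : h ∈ bergmanSpace U) {p : E} (hp : p ∈ U) :
    ∫ q in U, K p q * h q = h p := by
  obtain ⟨h1, h2⟩ := hK.projection h hh.2
  have h3 := bergmanSpace.sub hh h1
  exact (sub_eq_zero.1 (eqOn_zero_of_integral_mul_conj_eq_zero hU h3 (h2 _ h3) p hp)).symm

theorem IsBergmanKernel.eq_of_mem {K K' : E → E → ℂ} (hU : IsOpen U) (hK : IsBergmanKernel U K)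
    (hK' : IsBergmanKernel U K') {p q : E} (hp : p ∈ U) (hq : q ∈ U) : K p q = K' p q := by
  have hd := bergmanSpace.sub (hK.conj_mem p hp) (hK'.conj_mem p hp)
  -- both kernels evaluate the difference at `p`, so it has norm zero
  have h0 : ∫ q in U, (conj (K p q) - conj (K' p q)) * conj (conj (K p q) - conj (K' p q)) = 0 := by
    have e : ∀ q, (conj (K p q) - conj (K' p q)) * conj (conj (K p q) - conj (K' p q)) =
        K p q * (conj (K p q) - conj (K' p q)) - K' p q * (conj (K p q) - conj (K' p q)) := by
      intro q; simp; ring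
    simp only [e]
    rw [integral_sub (integrable_mul_of_memLp_two (hK.conj_mem p hp).2 hd.2)
      (integrable_mul_of_memLp_two (hK'.conj_mem p hp).2 hd.2), hK.reproducing hU hd hp,
      hK'.reproducing hU hd hp, sub_self]
  have := eqOn_zero_of_integral_mul_conj_eq_zero hU hd h0 q hq
  exact (starRingEnd ℂ).injective (sub_eq_zero.1 this)

end General

/-! ### Holomorphic dependence of integrals on a parameter -/

section Holomorphy

variable {E : Type*} [NormedAddCommGroup E] [NormedSpace ℂ E] [MeasureSpace E] [BorelSpace E]
  [FiniteDimensional ℂ E]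

/-- If `H` is smooth near `U × C` with `C` compact, then `∫ H (p, c q) * f q` is holomorphic in
`p ∈ U` for integrable `f`: the derivative of `H` is bounded on `B × C` for small closed balls `B`. -/
theorem differentiableOn_integral_of_contDiffOn {U C : Set E} (hU : IsOpen U) (hC : IsCompact C)
    {H : E × E → ℂ} {c : E → E} (hc : Continuous c) (hcU : Set.MapsTo c U C)
    {W : Set (E × E)} (hW : IsOpen W) (hUC : U ×ˢ C ⊆ W) (hH : ContDiffOn ℂ 1 H W)
    {f : E → ℂ} (hf : IntegrableOn f U) :
    DifferentiableOn ℂ (fun p => ∫ q in U, H (p, c q) * f q) U := by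
  have : ProperSpace E := FiniteDimensional.proper ℂ E
  intro p hp
  obtain ⟨r, hr, hrU⟩ := Metric.nhds_basis_closedBall.mem_iff.1 (hU.mem_nhds hp)
  have hK : IsCompact (Metric.closedBall p r ×ˢ C) := (isCompact_closedBall p r).prod hC
  have hKW : Metric.closedBall p r ×ˢ C ⊆ W := (Set.prod_mono hrU subset_rfl).trans hUC
  have hD : ContinuousOn (fun x => (fderiv ℂ H x).comp (ContinuousLinearMap.inl ℂ E E)) W :=
    (hH.continuousOn_fderiv_of_isOpen hW le_rfl).clm_comp continuousOn_const
  obtain ⟨M, hM⟩ := hK.exists_bound_of_continuousOn (hD.mono hKW)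
  obtain ⟨N, hN⟩ := hK.exists_bound_of_continuousOn (hH.continuousOn.mono hKW)
  have hmeas : ∀ x ∈ Metric.closedBall p r,
      AEStronglyMeasurable (fun q => H (x, c q)) (volume.restrict U) := fun x hx =>
    (hH.continuousOn.comp (by fun_prop : Continuous fun q => (x, c q)).continuousOn
      fun q hq => hKW ⟨hx, hcU hq⟩).aestronglyMeasurable hU.measurableSet
  have hpp : p ∈ Metric.closedBall p r := Metric.mem_closedBall_self hr.le
  refine (hasFDerivAt_integral_of_dominated_of_fderiv_le (𝕜 := ℂ)
    (F' := fun x q => f q • (fderiv ℂ H (x, c q)).comp (ContinuousLinearMap.inl ℂ E E))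
    (bound := fun q => M * ‖f q‖) (Metric.closedBall_mem_nhds p hr) ?_ ?_ ?_ ?_ ?_
    ?_).differentiableAt.differentiableWithinAt
  · filter_upwards [Metric.closedBall_mem_nhds p hr] with x hx
    exact (hmeas x hx).mul hf.1
  · refine Integrable.bdd_mul (c := N) hf (hmeas p hpp) ?_
    filter_upwards [ae_restrict_mem hU.measurableSet] with q hq
    exact hN _ ⟨hpp, hcU hq⟩
  · refine hf.1.smul (ContinuousOn.aestronglyMeasurable ?_ hU.measurableSet)
    exact hD.comp (by fun_prop : Continuous fun q => (p, c q)).continuousOn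
      fun q hq => hKW ⟨hpp, hcU hq⟩
  · filter_upwards [ae_restrict_mem hU.measurableSet] with q hq x hx
    rw [norm_smul, mul_comm]
    exact mul_le_mul_of_nonneg_right (hM _ ⟨hx, hcU hq⟩) (norm_nonneg _)
  · exact hf.norm.const_mul M
  · filter_upwards [ae_restrict_mem hU.measurableSet] with q hq x hx
    have hd : DifferentiableAt ℂ H (x, c q) :=
      (hH.differentiableOn one_ne_zero).differentiableAt (hW.mem_nhds (hKW ⟨hx, hcU hq⟩))
    have h1 : HasFDerivAt (fun x => (x, c q)) (ContinuousLinearMap.inl ℂ E E) x :=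
      hasFDerivAt_prodMk_left x (c q)
    exact (hd.hasFDerivAt.comp x h1).mul_const (f q)

end Holomorphy

/-! ### Products of domains -/

section Product

variable {E₁ E₂ : Type*} [NormedAddCommGroup E₁] [NormedSpace ℂ E₁] [MeasureSpace E₁]
  [NormedAddCommGroup E₂] [NormedSpace ℂ E₂] [MeasureSpace E₂]
  [BorelSpace E₁] [BorelSpace E₂] [SecondCountableTopology E₂]
  [SFinite (volume : Measure E₁)] [SFinite (volume : Measure E₂)]
  [(volume : Measure E₁).IsOpenPosMeasure] [(volume : Measure E₂).IsOpenPosMeasure]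

/-- The product of reproducing kernels reproduces the Bergman space of the product domain.
Almost every slice of a Bergman function is a Bergman function, which gives the reproducing
property for almost every `p`; by continuity it holds everywhere. -/
theorem IsReproducingKernel.prod {U₁ : Set E₁} {U₂ : Set E₂} (h₁ : IsOpen U₁) (h₂ : IsOpen U₂)
    {K₁ : E₁ → E₁ → ℂ} {K₂ : E₂ → E₂ → ℂ} (hK₁ : IsReproducingKernel U₁ K₁)
    (hK₂ : IsReproducingKernel U₂ K₂)
    (hd : ∀ f : E₁ × E₂ → ℂ, MemLp f 2 (volume.restrict (U₁ ×ˢ U₂)) →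
      DifferentiableOn ℂ (fun p => ∫ q in U₁ ×ˢ U₂, (K₁ p.1 q.1 * K₂ p.2 q.2) * f q) (U₁ ×ˢ U₂)) :
    IsReproducingKernel (U₁ ×ˢ U₂) fun p q => K₁ p.1 q.1 * K₂ p.2 q.2 := by
  have hμ : (volume : Measure (E₁ × E₂)).restrict (U₁ ×ˢ U₂) =
      ((volume : Measure E₁).restrict U₁).prod ((volume : Measure E₂).restrict U₂) := by
    rw [Measure.prod_restrict, Measure.volume_eq_prod]
  have hmem : ∀ p ∈ U₁ ×ˢ U₂,
      (fun q : E₁ × E₂ => conj (K₁ p.1 q.1 * K₂ p.2 q.2)) ∈ bergmanSpace (U₁ ×ˢ U₂) := by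
    intro p hp
    have a := hK₁.conj_mem p.1 hp.1
    have b := hK₂.conj_mem p.2 hp.2
    have hdiff : DifferentiableOn ℂ (fun q : E₁ × E₂ => conj (K₁ p.1 q.1 * K₂ p.2 q.2))
        (U₁ ×ˢ U₂) := by
      simp only [map_mul]
      exact (a.1.comp differentiableOn_fst fun q hq => hq.1).mul
        (b.1.comp differentiableOn_snd fun q hq => hq.2)
    refine ⟨hdiff, ?_⟩
    rw [memLp_two_iff_integrable_sq_norm
      (hdiff.continuousOn.aestronglyMeasurable (h₁.prod h₂).measurableSet), hμ]
    have := ((memLp_two_iff_integrable_sq_norm a.2.1).1 a.2).mul_prod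
      ((memLp_two_iff_integrable_sq_norm b.2.1).1 b.2)
    refine this.congr (Filter.Eventually.of_forall fun q => ?_)
    simp [mul_pow]
  refine ⟨hmem, ?_, hd⟩
  intro f hf
  have hsq : Integrable (fun q => ‖f q‖ ^ 2) (((volume : Measure E₁).restrict U₁).prod
      ((volume : Measure E₂).restrict U₂)) := by
    rw [← hμ]; exact (memLp_two_iff_integrable_sq_norm hf.2.1).1 hf.2
  have hcont := hf.1.continuousOn
  -- the slices in either direction
  have hs₂ : ∀ x ∈ U₁, Integrable (fun y => ‖f (x, y)‖ ^ 2) (volume.restrict U₂) →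
      (fun y => f (x, y)) ∈ bergmanSpace U₂ := by
    intro x hx hi
    have hdf : DifferentiableOn ℂ (fun y => f (x, y)) U₂ :=
      hf.1.comp (by fun_prop) fun y hy => ⟨hx, hy⟩
    exact ⟨hdf, (memLp_two_iff_integrable_sq_norm
      (hdf.continuousOn.aestronglyMeasurable h₂.measurableSet)).2 hi⟩
  have hs₁ : ∀ y ∈ U₂, Integrable (fun x => ‖f (x, y)‖ ^ 2) (volume.restrict U₁) →
      (fun x => f (x, y)) ∈ bergmanSpace U₁ := by
    intro y hy hi
    have hdf : DifferentiableOn ℂ (fun x => f (x, y)) U₁ :=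
      hf.1.comp (by fun_prop) fun x hx => ⟨hx, hy⟩
    exact ⟨hdf, (memLp_two_iff_integrable_sq_norm
      (hdf.continuousOn.aestronglyMeasurable h₁.measurableSet)).2 hi⟩
  have hiter : ∀ p ∈ U₁ ×ˢ U₂, ∫ q in U₁ ×ˢ U₂, (K₁ p.1 q.1 * K₂ p.2 q.2) * f q =
      ∫ x in U₁, K₁ p.1 x * f (x, p.2) := by
    intro p hp
    have hint := integrable_mul_of_memLp_two (hmem p hp).2 hf.2
    rw [hμ] at hint ⊢
    rw [integral_prod _ hint]
    refine integral_congr_ae ?_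
    filter_upwards [hsq.prod_right_ae, ae_restrict_mem h₁.measurableSet] with x hx hxU
    simp only [mul_assoc]
    rw [integral_const_mul, hK₂.reproducing _ (hs₂ x hxU hx) p.2 hp.2]
  have hae : (fun p : E₁ × E₂ => ∫ q in U₁ ×ˢ U₂, (K₁ p.1 q.1 * K₂ p.2 q.2) * f q)
      =ᵐ[volume.restrict (U₁ ×ˢ U₂)] f := by
    have h1 : ∀ᵐ p ∂(((volume : Measure E₁).restrict U₁).prod ((volume : Measure E₂).restrict U₂)),
        Integrable (fun x => ‖f (x, p.2)‖ ^ 2) (volume.restrict U₁) :=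
      Measure.quasiMeasurePreserving_snd.ae hsq.prod_left_ae
    rw [← hμ] at h1
    filter_upwards [h1, ae_restrict_mem (h₁.prod h₂).measurableSet] with p hp hpU
    rw [hiter p hpU, hK₁.reproducing _ (hs₁ p.2 hpU.2 hp) p.1 hpU.1]
  exact Measure.eqOn_open_of_ae_eq hae (h₁.prod h₂) (hd f hf.2).continuousOn hcont

end Product

/-! ### Change of variables -/

section Transfer

variable {E E' : Type*} [NormedAddCommGroup E] [NormedSpace ℂ E] [MeasureSpace E] [BorelSpace E]
  [NormedAddCommGroup E'] [NormedSpace ℂ E'] [MeasureSpace E'] [BorelSpace E']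

/-- Transformation rule for the Bergman kernel under a biholomorphic map `Φ : V → U` with inverse
`Ψ` and complex Jacobian `J`: `f ↦ J * (f ∘ Φ)` is a unitary map of Bergman spaces.  The hypothesis
`hmap` is the change of variables formula, with real Jacobian `‖J‖²`. -/
theorem IsReproducingKernel.transfer {U : Set E} {V : Set E'} (hU : IsOpen U) (hV : IsOpen V)
    {Φ : E' → E} {Ψ : E → E'} {J : E' → ℂ}
    (hΦ : DifferentiableOn ℂ Φ V) (hΦm : Measurable Φ) (hΦV : Set.MapsTo Φ V U)
    (hΨ : DifferentiableOn ℂ Ψ U) (hΨU : Set.MapsTo Ψ U V)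
    (hΦΨ : ∀ p ∈ U, Φ (Ψ p) = p)
    (hJ : DifferentiableOn ℂ J V) (hJm : Measurable J) (hJ0 : ∀ p ∈ V, J p ≠ 0)
    (hmap : volume.restrict U =
      ((volume.restrict V).withDensity fun p => (‖J p‖₊ ^ 2 : NNReal)).map Φ)
    {KU : E → E → ℂ} {KV : E' → E' → ℂ} (hKV : IsReproducingKernel V KV)
    (hrel : ∀ p ∈ V, ∀ q ∈ V, J p * KU (Φ p) (Φ q) * conj (J q) = KV p q) :
    IsReproducingKernel U KU := by
  have hm : Measurable fun p => ‖J p‖₊ ^ 2 := by fun_prop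
  have hac : volume.restrict V ≪
      (volume.restrict V).withDensity fun p => ((‖J p‖₊ ^ 2 : NNReal) : ENNReal) := by
    refine withDensity_absolutelyContinuous' (by fun_prop) ?_
    filter_upwards [ae_restrict_mem hV.measurableSet] with p hp
    simpa using hJ0 p hp
  -- `L²` norms and integrals in the new variables
  have hL2 : ∀ f : E → ℂ, AEStronglyMeasurable f (volume.restrict U) →
      (MemLp f 2 (volume.restrict U) ↔ MemLp (fun q => J q * f (Φ q)) 2 (volume.restrict V)) := by
    intro f hf
    have hf2 := hf
    rw [hmap] at hf2
    have hm1 : AEStronglyMeasurable (fun q => f (Φ q)) (volume.restrict V) :=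
      (hf2.comp_aemeasurable hΦm.aemeasurable).mono_ac hac
    rw [memLp_two_iff_integrable_sq_norm hf,
      memLp_two_iff_integrable_sq_norm (f := fun q => J q * f (Φ q))
        (hJm.aestronglyMeasurable.mul hm1), hmap,
      integrable_map_measure (f := Φ) (g := fun x => ‖f x‖ ^ 2) (hf2.norm.pow 2) hΦm.aemeasurable,
      integrable_withDensity_iff_integrable_smul hm]
    refine integrable_congr (Filter.Eventually.of_forall fun q => ?_)
    simp [mul_pow, NNReal.smul_def]
  have hintegral : ∀ G : E → ℂ, AEStronglyMeasurable G (volume.restrict U) →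
      ∫ q in U, G q = ∫ q in V, (J q * conj (J q)) * G (Φ q) := by
    intro G hG
    rw [hmap] at hG ⊢
    rw [integral_map hΦm.aemeasurable hG, integral_withDensity_eq_integral_smul hm]
    refine integral_congr_ae (Filter.Eventually.of_forall fun q => ?_)
    simp [NNReal.smul_def, Complex.mul_conj, Complex.normSq_eq_norm_sq]
  have hrel' : ∀ p ∈ U, ∀ q ∈ V, KU p (Φ q) = (J (Ψ p))⁻¹ * KV (Ψ p) q * (conj (J q))⁻¹ := by
    intro p hp q hq
    have h := hrel (Ψ p) (hΨU hp) q hq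
    rw [hΦΨ p hp] at h
    rw [← h]
    have h1 := hJ0 _ (hΨU hp)
    have h2 : conj (J q) ≠ 0 := (map_ne_zero _).2 (hJ0 q hq)
    field_simp
  have hmem : ∀ p ∈ U, (fun q => conj (KU p q)) ∈ bergmanSpace U := by
    intro p hp
    have hk := hKV.conj_mem _ (hΨU hp)
    have hdiff : DifferentiableOn ℂ (fun q => conj (KU p q)) U := by
      have : DifferentiableOn ℂ (fun q => conj ((J (Ψ p))⁻¹) * conj (KV (Ψ p) (Ψ q)) *
          (J (Ψ q))⁻¹) U :=
        ((hk.1.comp hΨ hΨU).const_mul _).mul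
          ((hJ.comp hΨ hΨU).inv fun q hq => hJ0 _ (hΨU hq))
      refine this.congr fun q hq => ?_
      have := hrel' p hp (Ψ q) (hΨU hq)
      rw [hΦΨ q hq] at this
      simp [this]
    refine ⟨hdiff, (hL2 _ (hdiff.continuousOn.aestronglyMeasurable hU.measurableSet)).2 ?_⟩
    refine (hk.2.const_mul (conj ((J (Ψ p))⁻¹))).ae_eq ?_
    filter_upwards [ae_restrict_mem hV.measurableSet] with q hq
    have := hJ0 q hq
    simp only [hrel' p hp q hq, map_mul, map_inv₀, Complex.conj_conj]
    field_simp
  have hpull : ∀ f : E → ℂ, MemLp f 2 (volume.restrict U) → ∀ p ∈ U,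
      ∫ q in U, KU p q * f q = (J (Ψ p))⁻¹ * ∫ q in V, KV (Ψ p) q * (J q * f (Φ q)) := by
    intro f hf p hp
    rw [hintegral _ (integrable_mul_of_memLp_two (hmem p hp).2 hf).1, ← integral_const_mul]
    refine setIntegral_congr_fun hV.measurableSet fun q hq => ?_
    have h2 : conj (J q) ≠ 0 := (map_ne_zero _).2 (hJ0 q hq)
    simp only [hrel' p hp q hq]
    field_simp
  refine ⟨hmem, ?_, ?_⟩
  · intro h hh p hp
    have hT : (fun q => J q * h (Φ q)) ∈ bergmanSpace V :=
      ⟨hJ.mul (hh.1.comp hΦ hΦV), (hL2 h hh.2.1).1 hh.2⟩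
    rw [hpull h hh.2 p hp, hKV.reproducing _ hT _ (hΨU hp), hΦΨ p hp,
      inv_mul_cancel_left₀ (hJ0 _ (hΨU hp))]
  · intro f hf
    have h1 := hKV.differentiableOn_integral _ ((hL2 f hf.1).1 hf)
    refine DifferentiableOn.congr ?_ (hpull f hf)
    exact ((hJ.comp hΨ hΨU).inv fun q hq => hJ0 _ (hΨU hq)).mul (h1.comp hΨ hΨU)

end Transfer

/-! ### The reproducing formula on the disc -/

/-- The Bergman kernel of the unit disc. -/
noncomputable def discKernel (z x : ℂ) : ℂ := (Real.pi * (1 - z * conj x) ^ 2)⁻¹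

theorem one_sub_mul_ne_zero {a b : ℂ} (ha : ‖a‖ < 1) (hb : ‖b‖ ≤ 1) : 1 - a * b ≠ 0 := by
  intro h
  have h1 : ‖a * b‖ = 1 := by rw [← sub_eq_zero.1 h]; simp
  rw [norm_mul] at h1
  nlinarith [norm_nonneg a, norm_nonneg b]

/-- On the circle of radius `r` one has `conj ζ = r² / ζ`, so the kernel becomes a Cauchy kernel and
the integral is the derivative of `ζ ↦ ζ * f ζ` at `r² * z`. -/
theorem integral_circleMap_discKernel {f : ℂ → ℂ} (hf : DifferentiableOn ℂ f (Metric.ball 0 1))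
    {z : ℂ} (hz : ‖z‖ < 1) {r : ℝ} (hr0 : 0 < r) (hr1 : r < 1) :
    ∫ θ in (-Real.pi)..Real.pi, discKernel z (circleMap 0 r θ) * f (circleMap 0 r θ) =
      2 * deriv (fun ζ => ζ * f ζ) (r ^ 2 * z) := by
  have hball : Metric.closedBall (0 : ℂ) r ⊆ Metric.ball 0 1 := Metric.closedBall_subset_ball hr1
  have hg : DifferentiableOn ℂ (fun ζ => ζ * f ζ) (Metric.ball 0 1) := differentiableOn_id.mul hf
  have hw : (r ^ 2 * z : ℂ) ∈ Metric.ball (0 : ℂ) r := by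
    simp only [Metric.mem_ball, dist_zero_right, norm_mul, norm_pow, Complex.norm_real,
      Real.norm_eq_abs, abs_of_pos hr0]
    have : r * ‖z‖ < 1 := by nlinarith [norm_nonneg z]
    nlinarith
  rw [← Complex.two_pi_I_inv_smul_circleIntegral_sub_sq_inv_smul_of_differentiable Metric.isOpen_ball
    hball hg hw, circleIntegral]
  have hper : ∀ g : ℂ → ℂ, ∫ θ in (-Real.pi)..Real.pi, g (circleMap 0 r θ) =
      ∫ θ in (0 : ℝ)..2 * Real.pi, g (circleMap 0 r θ) := by
    intro g
    have hp : Function.Periodic (fun θ => g (circleMap 0 r θ)) (2 * Real.pi) := fun θ => by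
      simp only [periodic_circleMap 0 r θ]
    have := hp.intervalIntegral_add_eq (-Real.pi) 0
    rwa [show -Real.pi + 2 * Real.pi = Real.pi by ring, zero_add] at this
  rw [hper (fun ζ => discKernel z ζ * f ζ), smul_eq_mul, ← mul_assoc,
    ← intervalIntegral.integral_const_mul]
  refine intervalIntegral.integral_congr fun θ _ => ?_
  have hpi : (Real.pi : ℂ) ≠ 0 := by exact_mod_cast Real.pi_ne_zero
  set ζ := circleMap 0 r θ with hζ
  have hn : ‖ζ‖ = r := by simp [hζ, abs_of_pos hr0]
  have hζ0 : ζ ≠ 0 := by rw [← norm_pos_iff, hn]; exact hr0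
  have hc : ζ * conj ζ = (r : ℂ) ^ 2 := by
    rw [Complex.mul_conj, Complex.normSq_eq_norm_sq, hn]; push_cast; rfl
  have hd : ζ - r ^ 2 * z ≠ 0 := by
    intro h
    rw [sub_eq_zero] at h
    rw [← h] at hw
    simp [hn] at hw
  have h1 : 1 - z * conj ζ ≠ 0 := one_sub_mul_ne_zero hz (by simp [hn, hr1.le])
  have h2 : ζ * (1 - z * conj ζ) = ζ - r ^ 2 * z := by rw [← hc]; ring
  simp only [discKernel, deriv_circleMap, smul_eq_mul, ← hζ]
  rw [← h2]
  field_simp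

/-- The integrand is the derivative of `r ↦ z⁻¹ * g (r² z)`, where `g ζ = ζ * f ζ`. -/
theorem integral_deriv_mul_self {f : ℂ → ℂ} (hf : DifferentiableOn ℂ f (Metric.ball 0 1))
    {z : ℂ} (hz : ‖z‖ < 1) :
    ∫ r in (0 : ℝ)..1, (r : ℂ) * (2 * deriv (fun ζ => ζ * f ζ) (r ^ 2 * z)) = f z := by
  set g : ℂ → ℂ := fun ζ => ζ * f ζ with hgdef
  have hg : DifferentiableOn ℂ g (Metric.ball 0 1) := differentiableOn_id.mul hf
  have hmem : ∀ r ∈ Set.uIcc (0 : ℝ) 1, (r ^ 2 * z : ℂ) ∈ Metric.ball (0 : ℂ) 1 := by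
    intro r hr
    rw [Set.uIcc_of_le zero_le_one] at hr
    simp only [Metric.mem_ball, dist_zero_right, norm_mul, norm_pow, Complex.norm_real,
      Real.norm_eq_abs, abs_of_nonneg hr.1]
    have : r ^ 2 ≤ 1 := pow_le_one₀ hr.1 hr.2
    nlinarith [norm_nonneg z]
  by_cases hz0 : z = 0
  · subst hz0
    have : deriv g 0 = f 0 := by
      have hd := ((hasDerivAt_id (0 : ℂ)).mul
        (hf.differentiableAt (Metric.ball_mem_nhds 0 one_pos)).hasDerivAt)
      exact hd.deriv.trans (by simp)
    simp only [mul_zero, this]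
    rw [intervalIntegral.integral_mul_const, intervalIntegral.integral_ofReal, integral_id]
    push_cast
    ring
  have hderiv : ∀ r ∈ Set.uIcc (0 : ℝ) 1, HasDerivAt (fun r : ℝ => z⁻¹ * g (r ^ 2 * z))
      ((r : ℂ) * (2 * deriv g (r ^ 2 * z))) r := by
    intro r hr
    have h1 : HasDerivAt (fun r : ℝ => ((r : ℂ) ^ 2 * z)) (2 * r * z) r := by
      have := ((hasDerivAt_id r).ofReal_comp.pow 2).mul_const z
      simpa using this
    have h2 := (hg.differentiableAt (Metric.isOpen_ball.mem_nhds (hmem r hr))).hasDerivAt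
    have h3 := (h2.scomp r h1).const_mul z⁻¹
    refine h3.congr_deriv ?_
    simp only [smul_eq_mul]
    field_simp
  rw [intervalIntegral.integral_eq_sub_of_hasDerivAt hderiv]
  · simp [hgdef, hz0]
  · refine ContinuousOn.intervalIntegrable ?_
    refine (by fun_prop : Continuous fun r : ℝ => (r : ℂ)).continuousOn.mul
      (continuousOn_const.mul ?_)
    exact ((hg.deriv Metric.isOpen_ball).continuousOn).comp
      (by fun_prop : Continuous fun r : ℝ => ((r : ℂ) ^ 2 * z)).continuousOn hmem

/-- Integration over the unit disc in polar coordinates, with the circle integrals as inner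
integrals. -/
theorem integral_ball_eq_integral_polar {G : ℂ → ℂ} (hc : ContinuousOn G (Metric.ball 0 1))
    (hG : IntegrableOn G (Metric.ball 0 1)) :
    ∫ ζ in Metric.ball (0 : ℂ) 1, G ζ =
      ∫ r in (0 : ℝ)..1, (r : ℂ) * ∫ θ in (-Real.pi)..Real.pi, G (circleMap 0 r θ) := by
  have hsymm : ∀ p : ℝ × ℝ, Complex.polarCoord.symm p = circleMap 0 p.1 p.2 := by
    rintro ⟨r, θ⟩
    simp [Complex.polarCoord_symm_apply, circleMap, Complex.exp_mul_I]
  have hB : MeasurableSet (Metric.ball (0 : ℂ) 1) := measurableSet_ball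
  have hR : MeasurableSet (Set.Ioo (0 : ℝ) 1 ×ˢ Set.Ioo (-Real.pi) Real.pi) :=
    measurableSet_Ioo.prod measurableSet_Ioo
  have hT : MeasurableSet polarCoord.target := polarCoord.open_target.measurableSet
  have hsub : Set.Ioo (0 : ℝ) 1 ×ˢ Set.Ioo (-Real.pi) Real.pi ⊆ polarCoord.target := by
    rintro ⟨r, θ⟩ ⟨h1, h2⟩
    exact ⟨h1.1, h2⟩
  have hmem : ∀ p ∈ polarCoord.target, (Complex.polarCoord.symm p ∈ Metric.ball (0 : ℂ) 1 ↔
      p ∈ Set.Ioo (0 : ℝ) 1 ×ˢ Set.Ioo (-Real.pi) Real.pi) := by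
    rintro ⟨r, θ⟩ ⟨h1, h2⟩
    have h1' : 0 < r := h1
    rw [hsymm]
    simp [abs_of_pos h1', h1', h2.1, h2.2]
  have hint : IntegrableOn (fun p : ℝ × ℝ => (p.1 : ℂ) * G (circleMap 0 p.1 p.2))
      (Set.Ioo (0 : ℝ) 1 ×ˢ Set.Ioo (-Real.pi) Real.pi) := by
    refine ⟨ContinuousOn.aestronglyMeasurable ?_ hR, ?_⟩
    · refine (by fun_prop : Continuous fun p : ℝ × ℝ => (p.1 : ℂ)).continuousOn.mul
        (hc.comp (by unfold circleMap; fun_prop :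
          Continuous fun p : ℝ × ℝ => circleMap 0 p.1 p.2).continuousOn ?_)
      intro p hp
      change circleMap 0 p.1 p.2 ∈ _
      rw [← hsymm]
      exact (hmem p (hsub hp)).2 hp
    · have h2 := hG.2
      rw [HasFiniteIntegral, ← lintegral_indicator hB, ← Complex.lintegral_comp_polarCoord_symm] at h2
      refine lt_of_le_of_lt ?_ h2
      refine le_trans (le_of_eq ?_) (lintegral_mono_set hsub)
      refine setLIntegral_congr_fun hR fun p hp => ?_
      have hp0 : 0 < p.1 := hp.1.1
      simp only [smul_eq_mul]
      rw [Set.indicator_of_mem ((hmem p (hsub hp)).2 hp), hsymm, enorm_mul]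
      congr 1
      rw [← ofReal_norm, Complex.norm_real, Real.norm_eq_abs, abs_of_pos hp0]
  rw [← integral_indicator hB, ← Complex.integral_comp_polarCoord_symm]
  have e : ∀ p ∈ polarCoord.target,
      p.1 • (Metric.ball (0 : ℂ) 1).indicator G (Complex.polarCoord.symm p) =
      (Set.Ioo (0 : ℝ) 1 ×ˢ Set.Ioo (-Real.pi) Real.pi).indicator
        (fun p : ℝ × ℝ => (p.1 : ℂ) * G (circleMap 0 p.1 p.2)) p := by
    intro p hp
    by_cases h : p ∈ Set.Ioo (0 : ℝ) 1 ×ˢ Set.Ioo (-Real.pi) Real.pi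
    · rw [Set.indicator_of_mem h, Set.indicator_of_mem ((hmem p hp).2 h), hsymm,
        Complex.real_smul]
    · rw [Set.indicator_of_notMem h, Set.indicator_of_notMem (fun h' => h ((hmem p hp).1 h')),
        smul_zero]
  rw [setIntegral_congr_fun hT e, setIntegral_indicator hR, Set.inter_eq_right.2 hsub,
    Measure.volume_eq_prod, setIntegral_prod _ hint, intervalIntegral.integral_of_le zero_le_one,
    integral_Ioc_eq_integral_Ioo]
  refine setIntegral_congr_fun measurableSet_Ioo fun r _ => ?_
  simp only
  rw [integral_const_mul, intervalIntegral.integral_of_le (by linarith [Real.pi_pos]),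
    integral_Ioc_eq_integral_Ioo]

theorem continuousOn_discKernel {z : ℂ} (hz : ‖z‖ < 1) :
    ContinuousOn (discKernel z) (Metric.closedBall 0 1) := by
  unfold discKernel
  refine ContinuousOn.inv₀ (by fun_prop) fun x hx => ?_
  have : ‖conj x‖ ≤ 1 := by simpa using hx
  exact mul_ne_zero (by exact_mod_cast Real.pi_ne_zero) (pow_ne_zero _ (one_sub_mul_ne_zero hz this))

theorem exists_norm_discKernel_le {z : ℂ} (hz : ‖z‖ < 1) :
    ∃ C, ∀ x ∈ Metric.closedBall (0 : ℂ) 1, ‖discKernel z x‖ ≤ C :=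
  (isCompact_closedBall 0 1).exists_bound_of_continuousOn (continuousOn_discKernel hz)

/-- The kernel of the disc reproduces integrable holomorphic functions. -/
theorem integral_discKernel_mul {f : ℂ → ℂ} (hf : DifferentiableOn ℂ f (Metric.ball 0 1))
    (hi : IntegrableOn f (Metric.ball 0 1)) {z : ℂ} (hz : ‖z‖ < 1) :
    ∫ x in Metric.ball (0 : ℂ) 1, discKernel z x * f x = f z := by
  obtain ⟨C, hC⟩ := exists_norm_discKernel_le hz
  have hk : ContinuousOn (discKernel z) (Metric.ball 0 1) :=
    (continuousOn_discKernel hz).mono Metric.ball_subset_closedBall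
  rw [integral_ball_eq_integral_polar (G := fun x => discKernel z x * f x)
    (hk.mul hf.continuousOn)]
  · rw [← integral_deriv_mul_self hf hz, intervalIntegral.integral_of_le zero_le_one,
      intervalIntegral.integral_of_le zero_le_one, integral_Ioc_eq_integral_Ioo,
      integral_Ioc_eq_integral_Ioo]
    refine setIntegral_congr_fun measurableSet_Ioo fun r hr => ?_
    rw [integral_circleMap_discKernel hf hz hr.1 hr.2]
  · refine Integrable.bdd_mul (c := C) hi (hk.aestronglyMeasurable measurableSet_ball) ?_
    filter_upwards [ae_restrict_mem measurableSet_ball] with x hx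
    exact hC x (Metric.ball_subset_closedBall hx)

/-! ### Removable singularities of square integrable holomorphic functions -/

/-- The area mean value property: the case `z = 0` of `integral_discKernel_mul`, rescaled. -/
theorem integral_ball_eq {U : Set ℂ} {F : ℂ → ℂ} (hF : DifferentiableOn ℂ F U)
    {c : ℂ} {r : ℝ} (hr : 0 < r) (hcU : Metric.closedBall c r ⊆ U) :
    ∫ ζ in Metric.ball c r, F ζ = Real.pi * r ^ 2 * F c := by
  have hmaps : Set.MapsTo (fun ζ : ℂ => c + r • ζ) (Metric.closedBall 0 1) U := by
    intro ζ hζ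
    apply hcU
    rw [mem_closedBall_zero_iff] at hζ
    simp only [Metric.mem_closedBall, dist_self_add_left, norm_smul, Real.norm_eq_abs, abs_of_pos hr]
    nlinarith
  have hd : DifferentiableOn ℂ (fun ζ : ℂ => F (c + r • ζ)) (Metric.closedBall 0 1) :=
    hF.comp (by fun_prop) hmaps
  have h1 := integral_discKernel_mul (hd.mono Metric.ball_subset_closedBall)
    ((hd.continuousOn.integrableOn_compact (isCompact_closedBall 0 1)).mono_set
      Metric.ball_subset_closedBall) (z := 0) (by simp)
  simp only [discKernel, zero_mul, sub_zero, one_pow, mul_one, smul_zero, add_zero] at h1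
  rw [integral_const_mul, Measure.setIntegral_comp_smul_of_pos volume (fun ζ => F (c + ζ)) _ hr,
    smul_unitBall_of_pos hr, Complex.finrank_real_complex] at h1
  have h2 : ∫ ζ in Metric.ball (0 : ℂ) r, F (c + ζ) = ∫ ζ in Metric.ball c r, F ζ := by
    have := (measurePreserving_add_left volume c).setIntegral_preimage_emb
      (measurableEmbedding_addLeft c) F (Metric.ball c r)
    simpa using this
  rw [h2] at h1
  have hpi : (Real.pi : ℂ) ≠ 0 := by exact_mod_cast Real.pi_ne_zero
  have hr' : (r : ℂ) ≠ 0 := by exact_mod_cast hr.ne'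
  rw [← h1, Complex.real_smul]
  push_cast
  field_simp

theorem isOpen_punctured_ball : IsOpen (Metric.ball (0 : ℂ) 1 \ {0}) :=
  Metric.isOpen_ball.sdiff isClosed_singleton

/-- A square integrable holomorphic function has a removable singularity at an isolated point: the
area mean value property of `f²` on the disc of radius `‖c‖ / 2` about `c` gives
`f c = o(1 / ‖c‖)`. -/
theorem exists_differentiableOn_eqOn_of_mem_bergmanSpace {f : ℂ → ℂ}
    (hf : f ∈ bergmanSpace (Metric.ball (0 : ℂ) 1 \ {0})) :
    ∃ g : ℂ → ℂ, DifferentiableOn ℂ g (Metric.ball 0 1) ∧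
      Set.EqOn f g (Metric.ball (0 : ℂ) 1 \ {0}) := by
  set U : Set ℂ := Metric.ball (0 : ℂ) 1 \ {0} with hU
  set μ : Measure ℂ := volume.restrict U with hμ
  have hsq : Integrable (fun q => f q ^ 2) μ := by
    refine ((memLp_two_iff_integrable_sq_norm hf.2.1).1 hf.2).congr' (hf.2.1.pow 2) ?_
    exact Filter.Eventually.of_forall fun q => by simp
  have hvol : Filter.Tendsto (fun c : ℂ => μ (Metric.ball c (‖c‖ / 2))) (nhdsWithin 0 {0}ᶜ)
      (nhds 0) := by
    have h1 : Filter.Tendsto (fun c : ℂ => ENNReal.ofReal (‖c‖ / 2) ^ 2 * NNReal.pi)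
        (nhdsWithin 0 {0}ᶜ) (nhds 0) := by
      have : Continuous fun c : ℂ => ENNReal.ofReal (‖c‖ / 2) ^ 2 * NNReal.pi :=
        (ENNReal.continuous_mul_const (by simp)).comp
          ((ENNReal.continuous_pow 2).comp (ENNReal.continuous_ofReal.comp (by fun_prop)))
      have h := this.tendsto 0
      simp only [norm_zero, zero_div, ENNReal.ofReal_zero, ne_eq, OfNat.ofNat_ne_zero,
        not_false_eq_true, zero_pow, zero_mul] at h
      exact h.mono_left nhdsWithin_le_nhds
    refine tendsto_of_tendsto_of_tendsto_of_le_of_le tendsto_const_nhds h1 (fun _ => zero_le)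
      fun c => ?_
    simp only
    rw [← Complex.volume_ball c]
    exact Measure.restrict_apply_le U _
  have hlim := hsq.tendsto_setIntegral_nhds_zero hvol
  have hnear : ∀ᶠ c in nhdsWithin (0 : ℂ) {0}ᶜ, c ∈ Metric.ball (0 : ℂ) (1 / 2) ∧ c ≠ 0 := by
    filter_upwards [nhdsWithin_le_nhds (Metric.ball_mem_nhds (0 : ℂ) (by norm_num : (0:ℝ) < 1 / 2)),
      self_mem_nhdsWithin] with c h1 h2
    exact ⟨h1, h2⟩
  have hval : ∀ c ∈ Metric.ball (0 : ℂ) (1 / 2), c ≠ 0 →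
      ∫ q in Metric.ball c (‖c‖ / 2), f q ^ 2 ∂μ = Real.pi / 4 * (‖c‖ ^ 2 * f c ^ 2) := by
    intro c hc hc0
    have hcp : 0 < ‖c‖ := norm_pos_iff.2 hc0
    have hsub : Metric.closedBall c (‖c‖ / 2) ⊆ U := by
      intro ζ hζ
      rw [mem_ball_zero_iff] at hc
      rw [Metric.mem_closedBall, dist_eq_norm] at hζ
      refine ⟨?_, ?_⟩
      · rw [mem_ball_zero_iff]
        have := norm_add_le (ζ - c) c
        rw [sub_add_cancel] at this
        linarith
      · rintro rfl
        rw [zero_sub, norm_neg] at hζ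
        linarith
    rw [hμ, Measure.restrict_restrict measurableSet_ball,
      Set.inter_eq_left.2 (Metric.ball_subset_closedBall.trans hsub),
      integral_ball_eq (F := fun q => f q ^ 2) (hf.1.pow 2) (by positivity) hsub]
    push_cast
    ring
  have ho : Filter.Tendsto (fun c => ‖c‖ * ‖f c‖) (nhdsWithin (0 : ℂ) {0}ᶜ) (nhds 0) := by
    -- square roots of the mean value identity, whose left side tends to zero
    have h1 : Filter.Tendsto (fun c => 4 / Real.pi *
        ‖∫ q in Metric.ball c (‖c‖ / 2), f q ^ 2 ∂μ‖) (nhdsWithin (0 : ℂ) {0}ᶜ) (nhds 0) := by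
      simpa using hlim.norm.const_mul (4 / Real.pi)
    have h2 := h1.sqrt
    rw [Real.sqrt_zero] at h2
    refine h2.congr' ?_
    filter_upwards [hnear] with c hc
    rw [hval c hc.1 hc.2, ← Real.sqrt_sq (by positivity : 0 ≤ ‖c‖ * ‖f c‖)]
    congr 1
    simp only [norm_mul, norm_div, norm_pow, Complex.norm_real, Real.norm_eq_abs,
      abs_of_pos Real.pi_pos, abs_norm, Complex.norm_ofNat]
    field_simp
  have hlittle : (fun z => f z - f 0) =o[nhdsWithin (0 : ℂ) {0}ᶜ] fun z => (z - 0)⁻¹ := by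
    have hinv : ∀ᶠ z in nhdsWithin (0 : ℂ) {0}ᶜ, (z - 0)⁻¹ = 0 → f z - f 0 = 0 := by
      filter_upwards [hnear] with z hz h
      simp [hz.2] at h
    rw [Asymptotics.isLittleO_iff_tendsto' hinv, tendsto_zero_iff_norm_tendsto_zero]
    have h0 : Filter.Tendsto (fun c : ℂ => ‖c‖ * ‖f 0‖) (nhdsWithin (0 : ℂ) {0}ᶜ) (nhds 0) := by
      have : Continuous fun c : ℂ => ‖c‖ * ‖f 0‖ := by fun_prop
      simpa using (this.tendsto 0).mono_left nhdsWithin_le_nhds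
    have hs := ho.add h0
    rw [add_zero] at hs
    refine squeeze_zero (fun _ => norm_nonneg _) (fun z => ?_) hs
    rw [sub_zero, div_inv_eq_mul, norm_mul, mul_comm, ← mul_add]
    exact mul_le_mul_of_nonneg_left (norm_sub_le _ _) (norm_nonneg _)
  exact ⟨_, Complex.differentiableOn_update_limUnder_of_isLittleO
    (Metric.ball_mem_nhds 0 one_pos) hf.1 hlittle, fun z hz => by
      rw [Function.update_of_ne hz.2]⟩

/-! ### The kernels of the disc and of the punctured disc -/

theorem conj_discKernel (z x : ℂ) : conj (discKernel z x) = discKernel x z := by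
  simp [discKernel, mul_comm]

theorem differentiableOn_conj_discKernel {z : ℂ} (hz : ‖z‖ < 1) :
    DifferentiableOn ℂ (fun x => conj (discKernel z x)) (Metric.ball 0 1) := by
  simp only [conj_discKernel]
  intro x hx
  rw [mem_ball_zero_iff] at hx
  unfold discKernel
  refine (DifferentiableAt.inv (by fun_prop) ?_).differentiableWithinAt
  exact mul_ne_zero (by exact_mod_cast Real.pi_ne_zero)
    (pow_ne_zero _ (one_sub_mul_ne_zero hx (by simpa using hz.le)))

theorem isFiniteMeasure_restrict_ball :
    IsFiniteMeasure (volume.restrict (Metric.ball (0 : ℂ) 1)) :=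
  ⟨by rw [Measure.restrict_apply_univ]; exact measure_ball_lt_top⟩

theorem memLp_conj_discKernel {z : ℂ} (hz : ‖z‖ < 1) :
    MemLp (fun x => conj (discKernel z x)) 2 (volume.restrict (Metric.ball (0 : ℂ) 1)) := by
  obtain ⟨C, hC⟩ := exists_norm_discKernel_le hz
  have := isFiniteMeasure_restrict_ball
  refine MemLp.of_bound ((differentiableOn_conj_discKernel hz).continuousOn.aestronglyMeasurable
    measurableSet_ball) C ?_
  filter_upwards [ae_restrict_mem measurableSet_ball] with x hx
  simpa using hC x (Metric.ball_subset_closedBall hx)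

theorem differentiableOn_integral_discKernel {f : ℂ → ℂ} (hf : IntegrableOn f (Metric.ball 0 1)) :
    DifferentiableOn ℂ (fun z => ∫ x in Metric.ball (0 : ℂ) 1, discKernel z x * f x)
      (Metric.ball 0 1) := by
  have hW : IsOpen {p : ℂ × ℂ | 1 - p.1 * p.2 ≠ 0} :=
    isOpen_ne_fun (by fun_prop) continuous_const
  refine differentiableOn_integral_of_contDiffOn Metric.isOpen_ball (isCompact_closedBall (0 : ℂ) 1)
    (H := fun p : ℂ × ℂ => (Real.pi * (1 - p.1 * p.2) ^ 2 : ℂ)⁻¹) (c := conj)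
    Complex.continuous_conj ?_ hW ?_ ?_ hf
  · intro x hx
    simpa using (mem_ball_zero_iff.1 hx).le
  · rintro ⟨z, t⟩ ⟨hz, ht⟩
    exact one_sub_mul_ne_zero (mem_ball_zero_iff.1 hz) (mem_closedBall_zero_iff.1 ht)
  · refine ContDiffOn.inv (by fun_prop) fun p hp => ?_
    exact mul_ne_zero (by exact_mod_cast Real.pi_ne_zero) (pow_ne_zero _ hp)

theorem isReproducingKernel_discKernel : IsReproducingKernel (Metric.ball (0 : ℂ) 1) discKernel := by
  have := isFiniteMeasure_restrict_ball
  refine ⟨fun p hp => ⟨differentiableOn_conj_discKernel (by simpa using hp),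
    memLp_conj_discKernel (by simpa using hp)⟩, fun f hf z hz => ?_, fun f hf => ?_⟩
  · exact integral_discKernel_mul hf.1 (hf.2.integrable one_le_two) (by simpa using hz)
  · exact differentiableOn_integral_discKernel (hf.integrable one_le_two)

theorem restrict_punctured_ball : (volume : Measure ℂ).restrict (Metric.ball 0 1 \ {0}) =
    volume.restrict (Metric.ball 0 1) :=
  Measure.restrict_congr_set (sdiff_null_ae_eq_self (measure_singleton 0))

/-- Puncturing the disc changes neither its Bergman space nor its kernel. -/
theorem isReproducingKernel_discKernel_punctured :
    IsReproducingKernel (Metric.ball (0 : ℂ) 1 \ {0}) discKernel := by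
  have hD := isReproducingKernel_discKernel
  have hsub : Metric.ball (0 : ℂ) 1 \ {0} ⊆ Metric.ball 0 1 := Set.sdiff_subset
  refine ⟨fun p hp => ?_, fun f hf z hz => ?_, fun f hf => ?_⟩
  · have h := hD.conj_mem p (hsub hp)
    exact ⟨h.1.mono hsub, restrict_punctured_ball ▸ h.2⟩
  · obtain ⟨g, hg, hfg⟩ := exists_differentiableOn_eqOn_of_mem_bergmanSpace hf
    have hg2 : g ∈ bergmanSpace (Metric.ball (0 : ℂ) 1) := by
      refine ⟨hg, ?_⟩
      rw [← restrict_punctured_ball]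
      exact hf.2.ae_eq ((ae_restrict_mem isOpen_punctured_ball.measurableSet).mono hfg)
    rw [hfg hz, ← hD.reproducing g hg2 z (hsub hz), ← restrict_punctured_ball]
    exact setIntegral_congr_fun isOpen_punctured_ball.measurableSet fun x hx => by
      simp only [hfg hx]
  · rw [restrict_punctured_ball] at hf ⊢
    exact (hD.differentiableOn_integral f hf).mono hsub

/-! ### The polydisc -/

/-- The Bergman kernel of the unit polydisc of `ℂⁿ`, which is the unit ball of `Fin n → ℂ` for the
supremum norm. -/
noncomputable def polydiscKernel (n : ℕ) (w y : Fin n → ℂ) : ℂ := ∏ j, discKernel (w j) (y j)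

/-- The kernel is a smooth function of `p` and of the conjugate of `q`, where the latter ranges over
the compact closed polydisc. -/
theorem differentiableOn_integral_discKernel_mul_polydiscKernel (n : ℕ) {U : Set ℂ} (hU : IsOpen U)
    (hU1 : U ⊆ Metric.ball 0 1) {f : ℂ × (Fin n → ℂ) → ℂ}
    (hf : MemLp f 2 (volume.restrict (U ×ˢ Metric.ball 0 1))) :
    DifferentiableOn ℂ (fun p => ∫ q in U ×ˢ Metric.ball 0 1,
      (discKernel p.1 q.1 * polydiscKernel n p.2 q.2) * f q) (U ×ˢ Metric.ball 0 1) := by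
  have hO : IsOpen (U ×ˢ Metric.ball (0 : Fin n → ℂ) 1) := hU.prod Metric.isOpen_ball
  have hfin : IsFiniteMeasure (volume.restrict (U ×ˢ Metric.ball (0 : Fin n → ℂ) 1)) := by
    refine ⟨?_⟩
    rw [Measure.restrict_apply_univ, Measure.volume_eq_prod, Measure.prod_prod]
    exact ENNReal.mul_lt_top ((measure_mono hU1).trans_lt measure_ball_lt_top) measure_ball_lt_top
  have hW : IsOpen {p : (ℂ × (Fin n → ℂ)) × (ℂ × (Fin n → ℂ)) |
      1 - p.1.1 * p.2.1 ≠ 0 ∧ ∀ j, 1 - p.1.2 j * p.2.2 j ≠ 0} := by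
    simp only [Set.ofPred_and, Set.ofPred_forall]
    exact (isOpen_ne_fun (by fun_prop) continuous_const).inter
      (isOpen_iInter_of_finite fun j => isOpen_ne_fun (by fun_prop) continuous_const)
  have hpi : (Real.pi : ℂ) ≠ 0 := by exact_mod_cast Real.pi_ne_zero
  refine differentiableOn_integral_of_contDiffOn hO
    ((isCompact_closedBall (0 : ℂ) 1).prod (isCompact_closedBall (0 : Fin n → ℂ) 1))
    (H := fun p : (ℂ × (Fin n → ℂ)) × (ℂ × (Fin n → ℂ)) =>
      (Real.pi * (1 - p.1.1 * p.2.1) ^ 2 : ℂ)⁻¹ *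
        ∏ j, (Real.pi * (1 - p.1.2 j * p.2.2 j) ^ 2 : ℂ)⁻¹)
    (c := fun q => (conj q.1, fun j => conj (q.2 j))) (by fun_prop) ?_ hW ?_ ?_
    (hf.integrable one_le_two)
  · rintro ⟨x, y⟩ ⟨hx, hy⟩
    refine ⟨by simpa using (mem_ball_zero_iff.1 (hU1 hx)).le, ?_⟩
    rw [mem_closedBall_zero_iff, pi_norm_le_iff_of_nonneg zero_le_one]
    intro j
    rw [mem_ball_zero_iff] at hy
    simpa using (norm_le_pi_norm y j).trans hy.le
  · rintro ⟨⟨z, w⟩, x, y⟩ ⟨⟨hz, hw⟩, hx, hy⟩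
    rw [mem_ball_zero_iff] at hw
    rw [mem_closedBall_zero_iff] at hx hy
    exact ⟨one_sub_mul_ne_zero (by simpa using hU1 hz) hx, fun j =>
      one_sub_mul_ne_zero ((norm_le_pi_norm w j).trans_lt hw) ((norm_le_pi_norm y j).trans hy)⟩
  · refine ContDiffOn.mul (ContDiffOn.inv (by fun_prop) fun p hp => ?_)
      (contDiffOn_prod fun j _ => ContDiffOn.inv (by fun_prop) fun p hp => ?_)
    · exact mul_ne_zero hpi (pow_ne_zero _ hp.1)
    · exact mul_ne_zero hpi (pow_ne_zero _ (hp.2 j))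

theorem isReproducingKernel_disc_prod_polydisc {n : ℕ} {U : Set ℂ} (hU : IsOpen U)
    (hU1 : U ⊆ Metric.ball 0 1) (hK : IsReproducingKernel U discKernel)
    (hn : IsReproducingKernel (Metric.ball (0 : Fin n → ℂ) 1) (polydiscKernel n)) :
    IsReproducingKernel (U ×ˢ Metric.ball (0 : Fin n → ℂ) 1)
      fun p q => discKernel p.1 q.1 * polydiscKernel n p.2 q.2 :=
  hK.prod hU Metric.isOpen_ball hn fun _ hf =>
    differentiableOn_integral_discKernel_mul_polydiscKernel n hU hU1 hf

theorem cons_mem_ball_iff {n : ℕ} (p : ℂ × (Fin n → ℂ)) :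
    (Fin.cons p.1 p.2 : Fin (n + 1) → ℂ) ∈ Metric.ball (0 : Fin (n + 1) → ℂ) 1 ↔
      p ∈ Metric.ball (0 : ℂ) 1 ×ˢ Metric.ball (0 : Fin n → ℂ) 1 := by
  simp [pi_norm_lt_iff one_pos, Fin.forall_fin_succ]

theorem isReproducingKernel_polydiscKernel (n : ℕ) :
    IsReproducingKernel (Metric.ball (0 : Fin n → ℂ) 1) (polydiscKernel n) := by
  induction n with
  | zero =>
    have hball : Metric.ball (0 : Fin 0 → ℂ) 1 = Set.univ := by
      ext x; simp [Subsingleton.elim x 0]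
    have hK : ∀ p q, polydiscKernel 0 p q = 1 := fun p q => by simp [polydiscKernel]
    have hd : ∀ g : (Fin 0 → ℂ) → ℂ, DifferentiableOn ℂ g Set.univ := fun g =>
      (differentiableOn_const (g 0)).congr fun x _ => by rw [Subsingleton.elim x 0]
    have hvol : (volume : Measure (Fin 0 → ℂ)) = Measure.dirac 0 := by
      rw [volume_pi, Measure.pi_of_empty (x := 0)]
    rw [hball]
    refine ⟨fun p _ => ⟨hd _, ?_⟩, fun h _ p _ => ?_, fun f _ => hd _⟩
    · simp only [hK, hvol, Measure.restrict_univ]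
      exact memLp_const _
    · simp [hK, hvol, Subsingleton.elim p 0]
  | succ n ih =>
    -- split off the first coordinate: `ℂⁿ⁺¹ ≃ ℂ × ℂⁿ` preserves volume, so the Jacobian is `1`
    have hΦm : MeasurePreserving (fun p : ℂ × (Fin n → ℂ) => (Fin.cons p.1 p.2 : Fin (n + 1) → ℂ))
        volume volume := by
      have h := (volume_preserving_piFinSuccAbove (fun _ : Fin (n + 1) => ℂ) 0).symm
      have e : ⇑(MeasurableEquiv.piFinSuccAbove (fun _ : Fin (n + 1) => ℂ) 0).symm =
          fun p : ℂ × (Fin n → ℂ) => (Fin.cons p.1 p.2 : Fin (n + 1) → ℂ) := by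
        ext p j
        simp [MeasurableEquiv.piFinSuccAbove, Fin.insertNthEquiv]
      exact e ▸ h
    have hpre : (fun p : ℂ × (Fin n → ℂ) => (Fin.cons p.1 p.2 : Fin (n + 1) → ℂ)) ⁻¹'
        Metric.ball 0 1 = Metric.ball (0 : ℂ) 1 ×ˢ Metric.ball (0 : Fin n → ℂ) 1 :=
      Set.ext fun p => cons_mem_ball_iff p
    have hmap := (hΦm.restrict_preimage (s := Metric.ball 0 1) measurableSet_ball).map_eq
    rw [hpre] at hmap
    refine (isReproducingKernel_disc_prod_polydisc Metric.isOpen_ball subset_rfl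
      isReproducingKernel_discKernel ih).transfer (J := fun _ => 1)
      (Φ := fun p => Fin.cons p.1 p.2) (Ψ := fun w => (w 0, fun j => w j.succ))
      Metric.isOpen_ball (Metric.isOpen_ball.prod Metric.isOpen_ball)
      (Fin.consEquivL ℂ fun _ : Fin (n + 1) => ℂ).differentiable.differentiableOn hΦm.measurable
      (fun p hp => (cons_mem_ball_iff p).2 hp)
      (by fun_prop) ?_ (fun p _ => Fin.cons_self_tail p) (by fun_prop) (by fun_prop)
      (fun _ _ => one_ne_zero) ?_ ?_
    · intro w hw
      rw [← cons_mem_ball_iff]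
      convert hw
      exact Fin.cons_self_tail w
    · simp [hmap]
    · intro p _ q _
      simp [polydiscKernel, Fin.prod_univ_succ]

/-! ### The generalized Hartogs triangle -/

/-- The product of the punctured unit disc and the unit polydisc, a model of `hartogsOmega n k`. -/
def puncturedPolydisc (n : ℕ) : Set (ℂ × (Fin n → ℂ)) :=
  (Metric.ball (0 : ℂ) 1 \ {0}) ×ˢ Metric.ball (0 : Fin n → ℂ) 1

theorem isOpen_puncturedPolydisc (n : ℕ) : IsOpen (puncturedPolydisc n) :=
  isOpen_punctured_ball.prod Metric.isOpen_ball

theorem isOpen_hartogsOmega (n k : ℕ) : IsOpen (hartogsOmega n k) := by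
  simp only [hartogsOmega, Set.ofPred_and, Set.ofPred_forall]
  exact (isOpen_iInter_of_finite fun j => isOpen_lt (by fun_prop) (by fun_prop)).inter
    (isOpen_lt (by fun_prop) (by fun_prop))

/-- The map `(z, u) ↦ (z, zᵏ u)` from `puncturedPolydisc n` onto `hartogsOmega n k`. -/
def hartogsMap (n k : ℕ) (p : ℂ × (Fin n → ℂ)) : ℂ × (Fin n → ℂ) := (p.1, p.1 ^ k • p.2)

/-- The inverse `(z, w) ↦ (z, z⁻ᵏ w)` of `hartogsMap n k`. -/
noncomputable def hartogsInv (n k : ℕ) (p : ℂ × (Fin n → ℂ)) : ℂ × (Fin n → ℂ) :=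
  (p.1, (p.1 ^ k)⁻¹ • p.2)

theorem measurable_hartogsMap (n k : ℕ) : Measurable (hartogsMap n k) :=
  (by unfold hartogsMap; fun_prop : Continuous (hartogsMap n k)).measurable

theorem fst_ne_zero_of_mem_hartogsOmega {n k : ℕ} (hn : 1 ≤ n) (hk : 1 ≤ k) {p : ℂ × (Fin n → ℂ)}
    (hp : p ∈ hartogsOmega n k) : p.1 ≠ 0 := by
  intro h
  have := hp.1 ⟨0, hn⟩
  rw [h, norm_zero, zero_pow (by omega)] at this
  exact (norm_nonneg _).not_gt this

theorem hartogsMap_mem_iff {n k : ℕ} (hn : 1 ≤ n) (hk : 1 ≤ k) (p : ℂ × (Fin n → ℂ)) :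
    hartogsMap n k p ∈ hartogsOmega n k ↔ p ∈ puncturedPolydisc n := by
  have h1 : ‖p.1‖ ^ k < 1 ↔ ‖p.1‖ < 1 := pow_lt_one_iff_of_nonneg (norm_nonneg _) (by omega)
  by_cases h0 : p.1 = 0
  · refine iff_of_false (fun h => fst_ne_zero_of_mem_hartogsOmega hn hk h h0) fun h => h.1.2 h0
  · have h2 : 0 < ‖p.1‖ ^ k := by positivity
    simp [hartogsMap, hartogsOmega, puncturedPolydisc, h0, h1, h2, pi_norm_lt_iff one_pos, and_comm]

theorem hartogsMap_hartogsInv {n k : ℕ} {p : ℂ × (Fin n → ℂ)} (hp : p.1 ≠ 0) :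
    hartogsMap n k (hartogsInv n k p) = p := by
  simp [hartogsMap, hartogsInv, smul_smul, hp]

/-- Multiplication by `a` has complex determinant `a ^ n` on `ℂⁿ`, hence real determinant
`‖a ^ n‖²`. -/
theorem volume_preimage_smul (n : ℕ) {a : ℂ} (ha : a ≠ 0) (s : Set (Fin n → ℂ)) :
    volume s = ((‖a ^ n‖₊ ^ 2 : NNReal) : ENNReal) * volume ((fun u => a • u) ⁻¹' s) := by
  let f : (Fin n → ℂ) →ₗ[ℝ] (Fin n → ℂ) :=
    (a • (LinearMap.id : (Fin n → ℂ) →ₗ[ℂ] (Fin n → ℂ))).restrictScalars ℝ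
  have hdet : LinearMap.det f = ‖a ^ n‖ ^ 2 := by
    rw [LinearMap.det_restrictScalars, LinearMap.det_smul, LinearMap.det_id,
      Algebra.norm_complex_apply, Complex.normSq_eq_norm_sq]
    simp
  have hpos : 0 < ‖a ^ n‖ ^ 2 := pow_pos (norm_pos_iff.2 (pow_ne_zero n ha)) 2
  have h := Measure.addHaar_preimage_linearMap (volume : Measure (Fin n → ℂ)) (f := f)
    (by rw [hdet]; exact hpos.ne') s
  have hf : ⇑f = fun u => a • u := rfl
  rw [hf, hdet, abs_of_pos (inv_pos.2 hpos)] at h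
  rw [h, ← mul_assoc]
  have : ((‖a ^ n‖₊ ^ 2 : NNReal) : ENNReal) = ENNReal.ofReal (‖a ^ n‖ ^ 2) := by
    rw [ENNReal.ofReal, Real.toNNReal_pow (norm_nonneg _), norm_toNNReal]
  rw [this, ← ENNReal.ofReal_mul hpos.le, mul_inv_cancel₀ hpos.ne', ENNReal.ofReal_one, one_mul]

/-- The change of variables formula for `hartogsMap`, with real Jacobian `|z ^ (n * k)|²`, slice by
slice over `z`. -/
theorem restrict_hartogsOmega_eq_map {n k : ℕ} (hn : 1 ≤ n) (hk : 1 ≤ k) :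
    volume.restrict (hartogsOmega n k) = ((volume.restrict (puncturedPolydisc n)).withDensity
      fun p => (‖p.1 ^ (n * k)‖₊ ^ 2 : NNReal)).map (hartogsMap n k) := by
  have hΦ := measurable_hartogsMap n k
  have hO := (isOpen_hartogsOmega n k).measurableSet
  have hV := (isOpen_puncturedPolydisc n).measurableSet
  ext s hs
  have hs' := hΦ hs
  rw [Measure.restrict_apply hs, Measure.map_apply hΦ hs, withDensity_apply _ hs',
    Measure.restrict_restrict hs', ← lintegral_indicator (hs'.inter hV), Measure.volume_eq_prod,
    Measure.prod_apply (hs.inter hO), lintegral_prod _ (Measurable.aemeasurable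
      (Measurable.indicator (by fun_prop) (hs'.inter hV)))]
  refine lintegral_congr fun z => ?_
  have hslice : MeasurableSet (Prod.mk z ⁻¹' (hartogsMap n k ⁻¹' s ∩ puncturedPolydisc n)) :=
    measurable_prodMk_left (hs'.inter hV)
  have e : ∀ u : Fin n → ℂ, (hartogsMap n k ⁻¹' s ∩ puncturedPolydisc n).indicator
      (fun p : ℂ × (Fin n → ℂ) => ((‖p.1 ^ (n * k)‖₊ ^ 2 : NNReal) : ENNReal)) (z, u) =
      (Prod.mk z ⁻¹' (hartogsMap n k ⁻¹' s ∩ puncturedPolydisc n)).indicator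
        (fun _ => ((‖z ^ (n * k)‖₊ ^ 2 : NNReal) : ENNReal)) u := fun u => rfl
  simp only [e]
  rw [lintegral_indicator_const hslice]
  by_cases hz : z = 0
  · have : Prod.mk z ⁻¹' (s ∩ hartogsOmega n k) = ∅ := by
      refine Set.eq_empty_of_forall_notMem fun w hw => ?_
      exact fst_ne_zero_of_mem_hartogsOmega hn hk hw.2 hz
    rw [this, hz, zero_pow (by positivity)]
    simp
  · have hpre : Prod.mk z ⁻¹' (hartogsMap n k ⁻¹' s ∩ puncturedPolydisc n) =
        (fun u => z ^ k • u) ⁻¹' (Prod.mk z ⁻¹' (s ∩ hartogsOmega n k)) := by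
      ext u
      exact and_congr Iff.rfl (hartogsMap_mem_iff hn hk (z, u)).symm
    rw [hpre, volume_preimage_smul n (pow_ne_zero k hz) (Prod.mk z ⁻¹' (s ∩ hartogsOmega n k)),
      ← pow_mul, mul_comm k n]

/-- The Bergman kernel of `hartogsOmega n k`. -/
noncomputable def hartogsKernel (n k : ℕ) (p q : ℂ × (Fin n → ℂ)) : ℂ :=
  (p.1 * conj q.1) ^ (n * k) /
    ((Real.pi : ℂ) ^ (n + 1) * (1 - p.1 * conj q.1) ^ 2 *
      ∏ j, ((p.1 * conj q.1) ^ k - p.2 j * conj (q.2 j)) ^ 2)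

theorem hartogsKernel_hartogsMap {n k : ℕ} {p q : ℂ × (Fin n → ℂ)} (hp : p.1 ≠ 0) (hq : q.1 ≠ 0) :
    p.1 ^ (n * k) * hartogsKernel n k (hartogsMap n k p) (hartogsMap n k q) *
      conj (q.1 ^ (n * k)) = discKernel p.1 q.1 * polydiscKernel n p.2 q.2 := by
  have hη : p.1 * conj q.1 ≠ 0 := mul_ne_zero hp ((map_ne_zero _).2 hq)
  have hprod : ∏ j, ((p.1 * conj q.1) ^ k - (p.1 ^ k • p.2) j * conj ((q.1 ^ k • q.2) j)) ^ 2 =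
      ((p.1 * conj q.1) ^ (n * k)) ^ 2 * ∏ j, (1 - p.2 j * conj (q.2 j)) ^ 2 := by
    have h : ∀ j, ((p.1 * conj q.1) ^ k - (p.1 ^ k • p.2) j * conj ((q.1 ^ k • q.2) j)) ^ 2 =
        ((p.1 * conj q.1) ^ k) ^ 2 * (1 - p.2 j * conj (q.2 j)) ^ 2 := by
      intro j
      simp only [Pi.smul_apply, smul_eq_mul, map_mul, map_pow]
      ring
    simp only [h]
    rw [Finset.prod_mul_distrib, Finset.prod_const, Finset.card_univ, Fintype.card_fin]
    congr 1
    ring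
  have hpoly : polydiscKernel n p.2 q.2 =
      ((Real.pi : ℂ) ^ n * ∏ j, (1 - p.2 j * conj (q.2 j)) ^ 2)⁻¹ := by
    simp only [polydiscKernel, discKernel]
    rw [Finset.prod_inv_distrib, Finset.prod_mul_distrib, Finset.prod_const, Finset.card_univ,
      Fintype.card_fin]
  have hN : (p.1 * conj q.1) ^ (n * k) ≠ 0 := pow_ne_zero _ hη
  have hmul : p.1 ^ (n * k) * conj (q.1 ^ (n * k)) = (p.1 * conj q.1) ^ (n * k) := by
    rw [map_pow, mul_pow]
  rw [hpoly, discKernel, mul_right_comm, hmul]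
  simp only [hartogsKernel, hartogsMap, hprod]
  generalize ∏ j, (1 - p.2 j * conj (q.2 j)) ^ 2 = P
  generalize (p.1 * conj q.1) ^ (n * k) = N at hN
  rw [← mul_inv, div_eq_mul_inv, show (Real.pi : ℂ) ^ (n + 1) * (1 - p.1 * conj q.1) ^ 2 *
    (N ^ 2 * P) = N ^ 2 * (Real.pi * (1 - p.1 * conj q.1) ^ 2 * (Real.pi ^ n * P)) by ring,
    mul_inv, ← mul_assoc, ← mul_assoc, ← pow_two, mul_inv_cancel₀ (pow_ne_zero 2 hN), one_mul]

theorem isReproducingKernel_hartogsKernel {n k : ℕ} (hn : 1 ≤ n) (hk : 1 ≤ k) :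
    IsReproducingKernel (hartogsOmega n k) (hartogsKernel n k) := by
  have hne : ∀ p ∈ hartogsOmega n k, p.1 ≠ 0 := fun p => fst_ne_zero_of_mem_hartogsOmega hn hk
  refine (isReproducingKernel_disc_prod_polydisc isOpen_punctured_ball Set.sdiff_subset
    isReproducingKernel_discKernel_punctured (isReproducingKernel_polydiscKernel n)).transfer
    (Φ := hartogsMap n k) (Ψ := hartogsInv n k) (J := fun p => p.1 ^ (n * k))
    (isOpen_hartogsOmega n k) (isOpen_puncturedPolydisc n) ?_ (measurable_hartogsMap n k)
    (fun p hp => (hartogsMap_mem_iff hn hk p).2 hp) ?_ ?_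
    (fun p hp => hartogsMap_hartogsInv (hne p hp)) (by fun_prop) (by fun_prop)
    (fun p hp => pow_ne_zero _ hp.1.2) (restrict_hartogsOmega_eq_map hn hk)
    fun p hp q hq => hartogsKernel_hartogsMap hp.1.2 hq.1.2
  · unfold hartogsMap
    fun_prop
  · unfold hartogsInv
    have h : DifferentiableOn ℂ (fun p : ℂ × (Fin n → ℂ) => (p.1 ^ k)⁻¹) (hartogsOmega n k) :=
      DifferentiableOn.inv (by fun_prop) fun p hp => pow_ne_zero _ (hne p hp)
    exact differentiableOn_fst.prodMk (h.smul differentiableOn_snd)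
  · intro p hp
    refine (hartogsMap_mem_iff hn hk _).1 ?_
    rwa [hartogsMap_hartogsInv (hne p hp)]

theorem mainTheorem1 (n k : ℕ) (hn : 1 ≤ n) (hk : 1 ≤ k)
    (K : ℂ × (Fin n → ℂ) → ℂ × (Fin n → ℂ) → ℂ) :
    IsBergmanKernel (hartogsOmega n k) K ↔
      ∀ z : ℂ, ∀ w : Fin n → ℂ, (z, w) ∈ hartogsOmega n k →
      ∀ x : ℂ, ∀ y : Fin n → ℂ, (x, y) ∈ hartogsOmega n k →
        K (z, w) (x, y) =
          (z * conj x) ^ (n * k) /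
            ((Real.pi : ℂ) ^ (n + 1) * (1 - z * conj x) ^ 2 *
              ∏ j, ((z * conj x) ^ k - w j * conj (y j)) ^ 2) := by
  have hO := isOpen_hartogsOmega n k
  have hK := (isReproducingKernel_hartogsKernel hn hk).isBergmanKernel hO.measurableSet
  constructor
  · intro h z w hp x y hq
    exact h.eq_of_mem hO hK hp hq
  · intro h
    exact hK.congr hO.measurableSet fun p hp q hq => h p.1 p.2 hp q.1 q.2 hq
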